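/- Let $M$ be a smooth real supermanifold of dimension $(p|q)$ with body $|M|$ and structure sheaf $\mathcal O_M$, and let $\nabla$ be a weight vector field on $M$, i.e. an even vector field such that around every point of $|M|$ there are local coordinates $(x^i)$ (some even, some odd) and real numbers $w_i$ with $\nabla(x^i)=w_i x^i$. A vector field $X$ (resp. a one-form $\alpha$) on $M$ is called homogeneous of degree $(\sigma,w)\in\mathbb Z_2\times\mathbb R$ if it has parity $\sigma$ and $[\nabla,X]=w X$ (resp. $\mathcal L_\nabla\alpha=w\alpha$). Contractions are left linear, $i_{fX}\alpha=f\,i_X\alpha$; the parity of forms and the Cartan calculus follow Deligne's sign convention, so that $\mathrm d$ is even; and $\ker \mathrm d\alpha$ consists of the vector fields $X$ with $i_X\mathrm d\alpha=0$. A one-form $\alpha$ on $M$ is called a contact form if (a) it is non-degenerate, i.e. its characteristic set $\chi(\alpha)=\ker\alpha\cap\ker\mathrm d\alpha\subseteq \mathsf TM$ is the zero section: at every $m\in|M|$ the only tangent vector $v\in\mathsf T_mM$ with $i_v\alpha_m=0$ and $i_v(\mathrm d\alpha)_m=0$ is $v=0$; and (b) the morphism $\flat_{\mathrm d\alpha}\colon\mathsf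 TM\to\mathsf T^*M$, $v\mapsto i_v\mathrm d\alpha$, of vector superbundles has constant rank $p+q-1$, i.e. around every point its matrix in suitable local homogeneous frames of $\mathsf TM$ and $\mathsf T^*M$ is the diagonal matrix $\operatorname{diag}(1,\dots,1,0)$ with $p+q-1$ ones. Let $\alpha$ be a contact form on $M$ which is homogeneous of degree $(\sigma,w)\in\mathbb Z_2\times\mathbb R$. Then there is a unique vector field $R$ on $M$ such that $$i_R\alpha=1,\qquad R\in\ker\mathrm d\alpha .$$ Moreover, $R$ is nowhere vanishing (its value in $\mathsf T_mM$ is non-zero for every $m\in|M|$) and homogeneous of degree $(\sigma,-w)$. -/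

import Mathlib

open CategoryTheory TopologicalSpace Opposite
open scoped Manifold ContDiff TensorProduct

noncomputable section

namespace SuperGeom

universe u

/-- The sign `(-1)^(i j)` for parities `i j : ZMod 2`. -/
def koszul (i j : ZMod 2) : ℝ := if i = 1 ∧ j = 1 then -1 else 1

theorem koszul_add_right (i j k : ZMod 2) : koszul i (j + k) = koszul i j * koszul i k := by
  have h : ∀ a : ZMod 2, a = 0 ∨ a = 1 := by decide
  have h2 : (1 + 1 : ZMod 2) = 0 := by decide
  rcases h i with rfl | rfl <;> rcases h j with rfl | rfl <;> rcases h k with rfl | rfl <;>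
    simp [koszul, h2]

theorem koszul_add_left (i j k : ZMod 2) : koszul (i + j) k = koszul i k * koszul j k := by
  have h : ∀ a : ZMod 2, a = 0 ∨ a = 1 := by decide
  have h2 : (1 + 1 : ZMod 2) = 0 := by decide
  rcases h i with rfl | rfl <;> rcases h j with rfl | rfl <;> rcases h k with rfl | rfl <;>
    simp [koszul, h2]

theorem koszul_comm (i j : ZMod 2) : koszul i j = koszul j i := by
  simp [koszul, and_comm]

theorem koszul_mul_self (i j : ZMod 2) : koszul i j * koszul i j = 1 := by
  unfold koszul; split_ifs <;> norm_num

/-- A topological space with a sheaf of supercommutative real superalgebras. -/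
structure SuperSpace : Type (u + 1) where
  carrier : TopCat.{u}
  sheaf : TopCat.Sheaf (AlgCat.{u} ℝ) carrier
  /-- the parity `i` part of the algebra of sections -/
  parity : ∀ U : Opens carrier, ZMod 2 → Submodule ℝ (sheaf.presheaf.obj (op U))
  graded : ∀ U : Opens carrier, GradedAlgebra (parity U)
  map_parity : ∀ {U V : Opens carrier} (h : V ≤ U) (i : ZMod 2)
    (f : sheaf.presheaf.obj (op U)), f ∈ parity U i →
      (sheaf.presheaf.map (homOfLE h).op).hom f ∈ parity V i
  supercomm : ∀ (U : Opens carrier) (i j : ZMod 2) (f g : sheaf.presheaf.obj (op U)),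
    f ∈ parity U i → g ∈ parity U j → f * g = koszul i j • (g * f)

namespace SuperSpace

variable (M : SuperSpace.{u})

/-- Superfunctions on the open set `U`. -/
abbrev O (U : Opens M.carrier) : Type u := M.sheaf.presheaf.obj (op U)

instance (U : Opens M.carrier) : GradedAlgebra (M.parity U) := M.graded U

variable {M}

/-- Restriction of superfunctions. -/
def res {U V : Opens M.carrier} (h : V ≤ U) : M.O U →ₐ[ℝ] M.O V :=
  (M.sheaf.presheaf.map (homOfLE h).op).hom

theorem res_res {U V W : Opens M.carrier} (h : V ≤ U) (h' : W ≤ V) (f : M.O U) :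
    res h' (res h f) = res (h'.trans h) f := by
  have : M.sheaf.presheaf.map (homOfLE (h'.trans h)).op =
      M.sheaf.presheaf.map (homOfLE h).op ≫ M.sheaf.presheaf.map (homOfLE h').op := by
    rw [← Functor.map_comp]; rfl
  unfold res
  rw [this]; rfl

/-- The parity `i` component of a superfunction. -/
def part {U : Opens M.carrier} (i : ZMod 2) (f : M.O U) : M.O U :=
  (DirectSum.decompose (M.parity U) f i : M.O U)

theorem part_mem {U : Opens M.carrier} (i : ZMod 2) (f : M.O U) :
    part i f ∈ M.parity U i := (DirectSum.decompose (M.parity U) f i).2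

/-- The germ of `f` at `m` lies in the maximal ideal of the local ring of germs at `m`,
i.e. `f` is not invertible on any neighbourhood of `m`. -/
def FunVanishesAt {U : Opens M.carrier} (f : M.O U) (m : M.carrier) : Prop :=
  ∀ (V : Opens M.carrier) (h : V ≤ U), m ∈ V → ¬ IsUnit (res h f)

variable (M)

/-- Vector fields of parity `s` on `U`: superderivations of parity `s` of the sheaf of
superfunctions restricted to `U`. -/
def HomVF (U : Opens M.carrier) (s : ZMod 2) :
    Submodule ℝ (∀ V : {V : Opens M.carrier // V ≤ U}, M.O V.1 →ₗ[ℝ] M.O V.1) where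
  carrier := {D |
    (∀ (V W : {V : Opens M.carrier // V ≤ U}) (h : W.1 ≤ V.1) (f : M.O V.1),
      res h (D V f) = D W (res h f)) ∧
    (∀ (V : {V : Opens M.carrier // V ≤ U}) (i : ZMod 2) (f : M.O V.1),
      f ∈ M.parity V.1 i → D V f ∈ M.parity V.1 (s + i)) ∧
    (∀ (V : {V : Opens M.carrier // V ≤ U}) (i : ZMod 2) (f g : M.O V.1),
      f ∈ M.parity V.1 i → D V (f * g) = D V f * g + koszul s i • (f * D V g))}
  zero_mem' := by
    refine ⟨fun V W h f => by simp, fun V i f _ => by simp, fun V i f g _ => by simp⟩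
  add_mem' := by
    rintro D E ⟨hD1, hD2, hD3⟩ ⟨hE1, hE2, hE3⟩
    refine ⟨fun V W h f => by simp [hD1 V W h, hE1 V W h],
      fun V i f hf => add_mem (hD2 V i f hf) (hE2 V i f hf), fun V i f g hf => ?_⟩
    simp only [Pi.add_apply, LinearMap.add_apply, hD3 V i f g hf, hE3 V i f g hf, add_mul, mul_add,
      smul_add]
    abel
  smul_mem' := by
    rintro c D ⟨hD1, hD2, hD3⟩
    refine ⟨fun V W h f => by simp [hD1 V W h],
      fun V i f hf => Submodule.smul_mem _ c (hD2 V i f hf), fun V i f g hf => ?_⟩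
    simp only [Pi.smul_apply, LinearMap.smul_apply, hD3 V i f g hf, smul_add, smul_mul_assoc,
      mul_smul_comm]
    rw [smul_comm]

/-- Vector fields on `U`; the component `X s` is the part of `X` of parity `s`. -/
abbrev VF (U : Opens M.carrier) : Type u := ∀ s : ZMod 2, M.HomVF U s

variable {M}

/-- A homogeneous vector field viewed as a vector field. -/
def ofHom {U : Opens M.carrier} (s : ZMod 2) (D : M.HomVF U s) : M.VF U := Pi.single s D

/-- `X` has parity `s`. -/
def VFHasParity {U : Opens M.carrier} (X : M.VF U) (s : ZMod 2) : Prop :=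
  ∀ t, t ≠ s → X t = 0

/-- The action of a vector field on superfunctions. -/
def VF.act {U : Opens M.carrier} (X : M.VF U) (f : M.O U) : M.O U :=
  ∑ s : ZMod 2, (X s).1 ⟨U, le_rfl⟩ f

/-- Restriction of vector fields. -/
def resVF {U V : Opens M.carrier} (h : V ≤ U) (X : M.VF U) : M.VF V := fun s =>
  ⟨fun W => (X s).1 ⟨W.1, W.2.trans h⟩,
    fun W W' => (X s).2.1 ⟨W.1, W.2.trans h⟩ ⟨W'.1, W'.2.trans h⟩,
    fun W => (X s).2.2.1 ⟨W.1, W.2.trans h⟩,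
    fun W => (X s).2.2.2 ⟨W.1, W.2.trans h⟩⟩

theorem mul_mem_HomVF {U : Opens M.carrier} {s t : ZMod 2} {f : M.O U}
    (hf : f ∈ M.parity U s) (D : M.HomVF U t) :
    (fun V : {V : Opens M.carrier // V ≤ U} =>
      (LinearMap.mulLeft ℝ (res V.2 f)) ∘ₗ D.1 V) ∈ M.HomVF U (s + t) := by
  obtain ⟨D, hD1, hD2, hD3⟩ := D
  refine ⟨fun V W h g => ?_, fun V i g hg => ?_, fun V i g k hg => ?_⟩
  · simp [hD1 V W h, res_res]
  · rw [add_assoc]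
    exact SetLike.mul_mem_graded (M.map_parity V.2 s f hf) (hD2 V i g hg)
  · have hc := M.supercomm V.1 s i (res V.2 f) g (M.map_parity V.2 s f hf) hg
    simp only [LinearMap.comp_apply, LinearMap.mulLeft_apply, hD3 V i g k hg, mul_add,
      mul_smul_comm]
    rw [← mul_assoc, ← mul_assoc, hc, koszul_add_left]
    simp only [smul_mul_assoc, smul_smul, mul_assoc]
    rw [mul_comm (koszul s i)]

/-- Left multiplication of a vector field by a superfunction, `(f X) g = f (X g)`. -/
def smulVF {U : Opens M.carrier} (f : M.O U) (X : M.VF U) : M.VF U := fun r =>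
  ∑ s : ZMod 2, ⟨fun V => LinearMap.mulLeft ℝ (res V.2 (part s f)) ∘ₗ (X (r - s)).1 V, by
    have h := mul_mem_HomVF (part_mem s f) (X (r - s))
    rwa [add_sub_cancel] at h⟩

theorem bracket_mem_HomVF {U : Opens M.carrier} {s t : ZMod 2}
    (D : M.HomVF U s) (E : M.HomVF U t) :
    (fun V : {V : Opens M.carrier // V ≤ U} =>
      D.1 V ∘ₗ E.1 V - koszul s t • (E.1 V ∘ₗ D.1 V)) ∈ M.HomVF U (s + t) := by
  obtain ⟨D, hD1, hD2, hD3⟩ := D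
  obtain ⟨E, hE1, hE2, hE3⟩ := E
  refine ⟨fun V W h g => ?_, fun V i g hg => ?_, fun V i g k hg => ?_⟩
  · simp [hD1 V W h, hE1 V W h]
  · refine sub_mem ?_ (Submodule.smul_mem _ _ ?_)
    · have := hD2 V _ _ (hE2 V i g hg)
      rwa [← add_assoc] at this
    · have := hE2 V _ _ (hD2 V i g hg)
      rwa [← add_assoc, add_comm t s] at this
  · simp only [LinearMap.sub_apply, LinearMap.smul_apply, LinearMap.comp_apply,
      hD3 V i g k hg, hE3 V i g k hg, map_add, map_smul,
      hD3 V _ _ k (hE2 V i g hg), hE3 V _ _ k (hD2 V i g hg), hD3 V i g _ hg, hE3 V i g _ hg,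
      koszul_add_right, koszul_add_left, koszul_comm t s, sub_mul, mul_sub,
      smul_add, smul_sub, smul_smul, smul_mul_assoc, mul_smul_comm]
    have h1 : koszul s t * (koszul s t * koszul t i) = koszul t i := by
      rw [← mul_assoc, koszul_mul_self, one_mul]
    rw [h1, show koszul s t * (koszul s i * koszul t i) =
      koszul s i * koszul t i * koszul s t by ring, mul_comm (koszul t i) (koszul s i)]
    abel_nf

/-- The Lie superbracket `[D, E] = D E - (-1)^(s t) E D` of homogeneous vector fields, extended
biadditively to all vector fields. -/
def bracket {U : Opens M.carrier} (X Y : M.VF U) : M.VF U := fun r =>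
  ∑ s : ZMod 2, ⟨fun V => (X s).1 V ∘ₗ (Y (r - s)).1 V
      - koszul s (r - s) • ((Y (r - s)).1 V ∘ₗ (X s).1 V), by
    have h := bracket_mem_HomVF (X s) (Y (r - s))
    rwa [add_sub_cancel] at h⟩

/-- The value of the vector field `X` in the fibre of the tangent bundle at `m` is zero: near `m`,
`X` is a combination of vector fields with coefficients in the maximal ideal at `m`. -/
def VFVanishesAt {U : Opens M.carrier} (X : M.VF U) (m : M.carrier) : Prop :=
  ∃ (V : Opens M.carrier) (h : V ≤ U) (k : ℕ) (f : Fin k → M.O V) (Y : Fin k → M.VF V),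
    m ∈ V ∧ (∀ i, FunVanishesAt (f i) m) ∧ resVF h X = ∑ i, smulVF (f i) (Y i)

/-- The homogeneous vector fields `X i` are free generators of the tangent sheaf over `U`. -/
def IsFrame {U : Opens M.carrier} {n : ℕ} (X : Fin n → M.VF U) : Prop :=
  (∀ i, ∃ s, VFHasParity (X i) s) ∧
  ∀ (V : Opens M.carrier) (h : V ≤ U) (Z : M.VF V),
    ∃! c : Fin n → M.O V, Z = ∑ i, smulVF (c i) (resVF h (X i))

variable (M)

/-- Differential one-forms on `M`: morphisms from the tangent sheaf to the sheaf of superfunctions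
which are linear over superfunctions, `X ↦ i_X α` with `i_{fX} α = f (i_X α)`. -/
structure OneForm where
  contr : ∀ {U : Opens M.carrier}, M.VF U →ₗ[ℝ] M.O U
  contr_smul : ∀ {U : Opens M.carrier} (f : M.O U) (X : M.VF U),
    contr (smulVF f X) = f * contr X
  contr_res : ∀ {U V : Opens M.carrier} (h : V ≤ U) (X : M.VF U),
    contr (resVF h X) = res h (contr X)

namespace OneForm

variable {M}
variable (α : M.OneForm)

/-- `α` has parity `σ`: contraction with a vector field of parity `s` has parity `s + σ`. -/
def HasParity (σ : ZMod 2) : Prop :=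
  ∀ (U : Opens M.carrier) (s : ZMod 2) (D : M.HomVF U s),
    α.contr (ofHom s D) ∈ M.parity U (s + σ)

/-- The double contraction `i_Y i_X dα`. For `X`, `Y` of parities `s`, `t`, Cartan's formulas
`L_X = i_X d + d i_X`, `i_{[X,Y]} = L_X i_Y - (-1)^(s t) i_Y L_X`, `i_Y df = Y f` give
`i_Y i_X dα = (-1)^(s t) X (i_Y α) - Y (i_X α) - (-1)^(s t) i_{[X,Y]} α`. -/
def dContr {U : Opens M.carrier} (X Y : M.VF U) : M.O U :=
  ∑ s : ZMod 2, ∑ t : ZMod 2,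
    (koszul s t • (ofHom s (X s)).act (α.contr (ofHom t (Y t)))
      - (ofHom t (Y t)).act (α.contr (ofHom s (X s)))
      - koszul s t • α.contr (bracket (ofHom s (X s)) (ofHom t (Y t))))

/-- `X ∈ ker dα`, i.e. the one-form `i_X dα` is zero. -/
def MemKerD {U : Opens M.carrier} (X : M.VF U) : Prop :=
  ∀ (V : Opens M.carrier) (h : V ≤ U) (Y : M.VF V), α.dContr (resVF h X) Y = 0

/-- The contraction `i_X (L_N α) = N (i_X α) - i_{[N,X]} α` of the Lie derivative of `α` along an
even vector field `N`. -/
def lieContr (N : M.HomVF ⊤ 0) {U : Opens M.carrier} (X : M.VF U) : M.O U :=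
  (resVF le_top (ofHom 0 N)).act (α.contr X) - α.contr (bracket (resVF le_top (ofHom 0 N)) X)

/-- `L_N α = w α`. -/
def HasWeight (N : M.HomVF ⊤ 0) (w : ℝ) : Prop :=
  ∀ (U : Opens M.carrier) (X : M.VF U), α.lieContr N X = w • α.contr X

/-- The value of `X` at `m` belongs to the fibre at `m` of the characteristic set
`ker α ∩ ker dα` in the tangent bundle. -/
def CharAt {U : Opens M.carrier} (X : M.VF U) (m : M.carrier) : Prop :=
  FunVanishesAt (α.contr X) m ∧
  ∀ (V : Opens M.carrier) (h : V ≤ U), m ∈ V → ∀ Y : M.VF V,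
    FunVanishesAt (α.dContr (resVF h X) Y) m

/-- The characteristic set `ker α ∩ ker dα` is the zero section of the tangent bundle. -/
def IsNondegenerate : Prop :=
  ∀ (m : M.carrier) (U : Opens M.carrier) (X : M.VF U), m ∈ U → α.CharAt X m → VFVanishesAt X m

/-- The morphism `X ↦ i_X dα` from the tangent to the cotangent bundle of a supermanifold of total
dimension `n` has constant rank `r`: around every point its matrix with respect to suitable
homogeneous frames (`X` of the tangent bundle, and the dual of `Y` in the cotangent bundle) is
the diagonal matrix with `r` ones followed by zeros. -/
def DHasRank (n r : ℕ) : Prop :=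
  r ≤ n ∧ ∀ m : M.carrier, ∃ (U : Opens M.carrier) (X Y : Fin n → M.VF U),
    m ∈ U ∧ IsFrame X ∧ IsFrame Y ∧
      ∀ i j, α.dContr (X i) (Y j) = if i = j ∧ (i : ℕ) < r then 1 else 0

end OneForm

/-- `[N, X] = w X`, i.e. `X` has weight `w` with respect to the even vector field `N`. -/
def VFHasWeight {M : SuperSpace.{u}} (N : M.HomVF ⊤ 0) (X : M.VF ⊤) (w : ℝ) : Prop :=
  bracket (ofHom 0 N) X = w • X

end SuperSpace

/-- Smooth functions on an open subset of `ℝ^p`. -/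
abbrev Smooth {p : ℕ} (V : Opens (EuclideanSpace ℝ (Fin p))) : Type :=
  C^∞⟮𝓘(ℝ, EuclideanSpace ℝ (Fin p)), V; 𝓘(ℝ, ℝ), ℝ⟯

/-- Restriction of smooth functions. -/
def smoothRes {p : ℕ} {V W : Opens (EuclideanSpace ℝ (Fin p))} (h : W ≤ V) :
    Smooth V →ₐ[ℝ] Smooth W :=
  { ContMDiffMap.restrictRingHom 𝓘(ℝ, EuclideanSpace ℝ (Fin p)) 𝓘(ℝ, ℝ) ℝ h with
    commutes' := fun _ => rfl }

/-- The exterior algebra on `q` generators. -/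
abbrev Grassmann (q : ℕ) : Type := ExteriorAlgebra ℝ (Fin q → ℝ)

/-- Superfunctions on the open subset `V` of `ℝ^{p|q}`. -/
abbrev Model {p : ℕ} (q : ℕ) (V : Opens (EuclideanSpace ℝ (Fin p))) : Type :=
  Smooth V ⊗[ℝ] Grassmann q

/-- Restriction of superfunctions on `ℝ^{p|q}`. -/
def modelRes {p : ℕ} (q : ℕ) {V W : Opens (EuclideanSpace ℝ (Fin p))} (h : W ≤ V) :
    Model q V →ₐ[ℝ] Model q W :=
  Algebra.TensorProduct.map (smoothRes h) (AlgHom.id ℝ (Grassmann q))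

/-- The `i`-th coordinate function. -/
def coordFun {p : ℕ} (V : Opens (EuclideanSpace ℝ (Fin p))) (i : Fin p) : Smooth V :=
  ⟨fun v => v.1 i, by
    have h : ContMDiff 𝓘(ℝ, EuclideanSpace ℝ (Fin p)) 𝓘(ℝ, ℝ) ∞
        (fun v : EuclideanSpace ℝ (Fin p) => v i) :=
      ContDiff.contMDiff (by fun_prop)
    exact h.comp contMDiff_subtype_val⟩

/-- A chart: an isomorphism of superspaces from an open part of `M` onto an open part of
`ℝ^{p|q}`. -/
structure Chart (M : SuperSpace.{u}) (p q : ℕ) where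
  homeo : OpenPartialHomeomorph M.carrier (EuclideanSpace ℝ (Fin p))
  iso : ∀ V : Opens (EuclideanSpace ℝ (Fin p)), (V : Set _) ⊆ homeo.target →
    Model q V ≃ₐ[ℝ] M.O ⟨homeo.source ∩ homeo ⁻¹' V, homeo.isOpen_inter_preimage V.2⟩
  iso_res : ∀ (V W : Opens (EuclideanSpace ℝ (Fin p))) (hV : (V : Set _) ⊆ homeo.target)
    (h : W ≤ V) (f : Model q V),
    SuperSpace.res (Set.inter_subset_inter_right _ (Set.preimage_mono h)) (iso V hV f) =
      iso W (subset_trans (SetLike.coe_subset_coe.2 h) hV) (modelRes q h f)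
  iso_parity : ∀ (V : Opens (EuclideanSpace ℝ (Fin p))) (hV : (V : Set _) ⊆ homeo.target)
    (i : ZMod 2) (f : Smooth V) (a : Grassmann q),
    a ∈ CliffordAlgebra.evenOdd (0 : QuadraticForm ℝ (Fin q → ℝ)) i →
      iso V hV (f ⊗ₜ a) ∈ M.parity _ i

namespace Chart

variable {M : SuperSpace.{u}} {p q : ℕ} (c : Chart M p q)

/-- The domain of a chart. -/
def domain : Opens M.carrier :=
  ⟨c.homeo.source ∩ c.homeo ⁻¹' (⟨c.homeo.target, c.homeo.open_target⟩ : Opens _),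
    c.homeo.isOpen_inter_preimage c.homeo.open_target⟩

/-- The coordinates of a chart: `p` even ones and `q` odd ones. -/
def coord : Fin p ⊕ Fin q → M.O c.domain
  | Sum.inl i => c.iso ⟨c.homeo.target, c.homeo.open_target⟩ subset_rfl (coordFun _ i ⊗ₜ 1)
  | Sum.inr j => c.iso ⟨c.homeo.target, c.homeo.open_target⟩ subset_rfl
      (1 ⊗ₜ ExteriorAlgebra.ι ℝ (Pi.single j 1))

end Chart

/-- A smooth supermanifold of dimension `p|q`. -/
structure Supermanifold (p q : ℕ) : Type (u + 1) extends SuperSpace.{u} where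
  t2 : T2Space carrier
  secondCountable : SecondCountableTopology carrier
  exists_chart : ∀ m : carrier, ∃ c : Chart toSuperSpace p q, m ∈ c.domain

/-- An even vector field is a weight vector field if around every point there are coordinates
`x i` with `N (x i) = w i x i` for real numbers `w i`. -/
def IsWeightVF {p q : ℕ} (M : Supermanifold.{u} p q) (N : M.HomVF ⊤ 0) : Prop :=
  ∀ m : M.carrier, ∃ (c : Chart M.toSuperSpace p q) (w : Fin p ⊕ Fin q → ℝ),
    m ∈ c.domain ∧ ∀ i, N.1 ⟨c.domain, le_top⟩ (c.coord i) = w i • c.coord i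

/-- Contact forms: non-degenerate one-forms such that `X ↦ i_X dα` has constant rank equal to the
total dimension minus one. -/
def IsContact {p q : ℕ} (M : Supermanifold.{u} p q) (α : M.OneForm) : Prop :=
  α.IsNondegenerate ∧ ∃ r : ℕ, α.DHasRank (p + q) r ∧ p + q = r + 1

end SuperGeom

end

/-!
Over a small open set `ker dα` is free of rank one, spanned by the last vector `X` of the frame
that diagonalizes `dα`. A member of a frame vanishes at no point, so non-degeneracy of `α` forces
`i_X α` to be invertible there: `α` is injective on `ker dα`, and `(i_X α)⁻¹ X` is a Reeb field.
Being unique, the local Reeb fields agree on overlaps and glue. The same injectivity yields the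
degree of the Reeb field `R`: its component of the parity of `α` is again a Reeb field, and
`[N, R]` and `-w R` are members of `ker dα` with the same contraction with `α`.
-/

noncomputable section

namespace SuperGeom

universe u

theorem koszul_zero_left (i : ZMod 2) : koszul 0 i = 1 := by simp [koszul]

theorem koszul_mul_self_smul {A : Type*} [AddCommGroup A] [Module ℝ A] (i j : ZMod 2) (a : A) :
    koszul i j • koszul i j • a = a := by
  rw [smul_smul, koszul_mul_self, one_smul]

namespace SuperSpace

variable {M : SuperSpace.{u}} {U V W : Opens M.carrier}

/-! ### Superfunctions -/

section Superfunctions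

variable {i c : ZMod 2} {f : M.O U}

theorem res_mem (h : V ≤ U) (hf : f ∈ M.parity U i) : res h f ∈ M.parity V i :=
  M.map_parity h i f hf

theorem res_self (h : U ≤ U) (f : M.O U) : res h f = f := by simp [res]

theorem one_mem_parity : (1 : M.O U) ∈ M.parity U 0 := SetLike.GradedOne.one_mem

theorem part_of_mem (hf : f ∈ M.parity U i) (j : ZMod 2) : part j f = if j = i then f else 0 := by
  split_ifs with h
  · exact h ▸ DirectSum.decompose_of_mem_same _ hf
  · exact DirectSum.decompose_of_mem_ne _ hf (Ne.symm h)

theorem sum_part (f : M.O U) : ∑ i, part i f = f := by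
  classical
  conv_rhs => rw [← DirectSum.sum_support_decompose (M.parity U) f]
  exact (Finset.sum_subset (Finset.subset_univ _) (by simp [part])).symm

theorem part_sum {ι : Type*} (T : Finset ι) (F : ι → M.O U) (i : ZMod 2) :
    part i (∑ k ∈ T, F k) = ∑ k ∈ T, part i (F k) :=
  map_sum (GradedRing.proj (M.parity U) i) F T

theorem part_sum_of_mem {F : ZMod 2 → M.O U} (hF : ∀ s, F s ∈ M.parity U (s + c)) (s : ZMod 2) :
    part (s + c) (∑ t, F t) = F s := by
  simp only [part_sum, part_of_mem (hF _), add_left_inj, Finset.sum_ite_eq, Finset.mem_univ,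
    if_true]

theorem res_part (h : V ≤ U) (i : ZMod 2) (f : M.O U) : res h (part i f) = part i (res h f) := by
  have hF (s : ZMod 2) : res h (part s f) ∈ M.parity V (s + 0) := by
    simpa using res_mem h (part_mem s f)
  simpa [← map_sum, sum_part] using (part_sum_of_mem hF i).symm

theorem O.induction {P : M.O U → Prop} (f : M.O U) (hom : ∀ i, ∀ f ∈ M.parity U i, P f)
    (add : ∀ f g, P f → P g → P (f + g)) : P f :=
  DirectSum.Decomposition.inductionOn (M.parity U) (hom 0 0 (zero_mem _))
    (fun f => hom _ f f.2) add f

/-- The sign rule: `twist t f` is `f` with the sign it acquires when it is moved past an object of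
parity `t`. -/
def twist (t : ZMod 2) : M.O U →ₗ[ℝ] M.O U :=
  ∑ i, koszul i t • (M.parity U i).subtype ∘ₗ
    DirectSum.component ℝ (ZMod 2) (fun i => M.parity U i) i ∘ₗ
      (DirectSum.decomposeLinearEquiv (M.parity U)).toLinearMap

theorem twist_of_mem (hf : f ∈ M.parity U i) (t : ZMod 2) : twist t f = koszul i t • f := by
  have h : twist t f = ∑ j, koszul j t • part j f := by
    simp only [twist, LinearMap.sum_apply]; rfl
  simp only [h, part_of_mem hf, smul_ite, smul_zero, Finset.sum_ite_eq', Finset.mem_univ, if_true]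

theorem twist_twist (t : ZMod 2) (f : M.O U) : twist t (twist t f) = f := by
  induction f using O.induction with
  | hom i f hf => rw [twist_of_mem hf, map_smul, twist_of_mem hf, koszul_mul_self_smul]
  | add f g hf hg => rw [map_add, map_add, hf, hg]

theorem twist_injective (t : ZMod 2) : Function.Injective (twist t : M.O U → M.O U) :=
  (show Function.Involutive _ from twist_twist t).injective

end Superfunctions

/-! ### Vector fields -/

section VectorFields

variable {s t a i : ZMod 2} {X Y : M.VF U}

theorem VF.ext (h : ∀ r W, (X r).1 W = (Y r).1 W) : X = Y :=
  funext fun r => Subtype.ext (funext (h r))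

/-- The action of vector fields on superfunctions, as a linear map into the endomorphisms. -/
def toEnd : M.VF U →ₗ[ℝ] Module.End ℝ (M.O U) where
  toFun X := ∑ s, (X s).1 ⟨U, le_rfl⟩
  map_add' X Y := Finset.sum_add_distrib
  map_smul' c X := by
    simp only [Pi.smul_apply, SetLike.val_smul, Finset.smul_sum, RingHom.id_apply]

theorem toEnd_eq_sum (X : M.VF U) : toEnd X = ∑ s, (X s).1 ⟨U, le_rfl⟩ := rfl

theorem toEnd_apply (X : M.VF U) (f : M.O U) : toEnd X f = ∑ s, (X s).1 ⟨U, le_rfl⟩ f :=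
  LinearMap.sum_apply ..

theorem act_eq_toEnd (X : M.VF U) (f : M.O U) : X.act f = toEnd X f := (toEnd_apply X f).symm

theorem resVF_add (h : V ≤ U) (X Y : M.VF U) : resVF h (X + Y) = resVF h X + resVF h Y := rfl

theorem resVF_zero (h : V ≤ U) : resVF h (0 : M.VF U) = 0 := rfl

theorem resVF_smul_real (h : V ≤ U) (c : ℝ) (X : M.VF U) : resVF h (c • X) = c • resVF h X := rfl

theorem resVF_resVF (h : V ≤ U) (h' : W ≤ V) (X : M.VF U) :
    resVF h' (resVF h X) = resVF (h'.trans h) X := rfl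

theorem res_toEnd (h : V ≤ U) (X : M.VF U) (f : M.O U) :
    res h (toEnd X f) = toEnd (resVF h X) (res h f) := by
  simp only [toEnd_apply, map_sum]
  exact Finset.sum_congr rfl fun s _ => (X s).2.1 ⟨U, le_rfl⟩ ⟨V, h⟩ h f

theorem part_toEnd (X : M.VF U) (h : V ≤ U) {f : M.O V} (hf : f ∈ M.parity V i) (r : ZMod 2) :
    part (r + i) (toEnd (resVF h X) f) = (X r).1 ⟨V, h⟩ f := by
  rw [toEnd_apply]
  exact part_sum_of_mem (fun s => (X s).2.2.1 ⟨V, h⟩ i f hf) r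

theorem VF.ext_toEnd
    (H : ∀ (V : Opens M.carrier) (h : V ≤ U), toEnd (resVF h X) = toEnd (resVF h Y)) : X = Y := by
  refine VF.ext fun r ⟨V, h⟩ => LinearMap.ext fun f => ?_
  induction f using O.induction with
  | hom i f hf => rw [← part_toEnd X h hf, ← part_toEnd Y h hf, H]
  | add f g hf hg => rw [map_add, map_add, hf, hg]

theorem VFHasParity.ofHom (D : M.HomVF U s) : VFHasParity (SuperSpace.ofHom s D) s :=
  fun _ ht => Pi.single_eq_of_ne (M := fun s => M.HomVF U s) ht D

theorem VFHasParity.eq_ofHom (hX : VFHasParity X s) : X = SuperSpace.ofHom s (X s) := by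
  refine funext fun t => ?_
  by_cases ht : t = s
  · subst ht
    exact (Pi.single_eq_same (M := fun s => M.HomVF U s) t (X t)).symm
  · rw [hX t ht, VFHasParity.ofHom _ t ht]

theorem sum_ofHom (X : M.VF U) : ∑ s, ofHom s (X s) = X := Finset.univ_sum_single X

theorem resVF_ofHom (h : V ≤ U) (X : M.VF U) (s : ZMod 2) :
    resVF h (ofHom s (X s)) = ofHom s (resVF h X s) := by
  refine funext fun t => ?_
  by_cases ht : t = s
  · subst ht
    simp only [resVF, ofHom, Pi.single_eq_same]
  · simp only [resVF, VFHasParity.ofHom _ t ht]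
    rfl

theorem VF.induction {P : M.VF U → Prop} (X : M.VF U) (hom : ∀ s X, VFHasParity X s → P X)
    (add : ∀ X Y, P X → P Y → P (X + Y)) : P X := by
  rw [← sum_ofHom X]
  exact Finset.sum_induction _ P add (hom 0 0 fun _ _ => rfl)
    fun s _ => hom s _ (VFHasParity.ofHom _)

namespace VFHasParity

theorem resVF (hX : VFHasParity X s) (h : V ≤ U) : VFHasParity (resVF h X) s := fun t ht => by
  simp only [SuperSpace.resVF, hX t ht]; rfl

theorem toEnd_eq (hX : VFHasParity X s) : toEnd X = (X s).1 ⟨U, le_rfl⟩ :=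
  Fintype.sum_eq_single (f := fun s => (X s).1 ⟨U, le_rfl⟩) s fun t ht => by rw [hX t ht]; rfl

theorem toEnd_mem (hX : VFHasParity X s) {f : M.O U} (hf : f ∈ M.parity U i) :
    toEnd X f ∈ M.parity U (s + i) :=
  hX.toEnd_eq ▸ (X s).2.2.1 ⟨U, le_rfl⟩ i f hf

theorem toEnd_mul (hX : VFHasParity X s) {f : M.O U} (hf : f ∈ M.parity U i) (g : M.O U) :
    toEnd X (f * g) = toEnd X f * g + koszul s i • (f * toEnd X g) :=
  hX.toEnd_eq ▸ (X s).2.2.2 ⟨U, le_rfl⟩ i f g hf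

end VFHasParity

theorem toEnd_one (X : M.VF U) : toEnd X 1 = 0 := by
  induction X using VF.induction with
  | hom s X hX =>
    simpa [koszul_comm s, koszul_zero_left] using hX.toEnd_mul one_mem_parity 1
  | add X Y hX hY => rw [map_add, LinearMap.add_apply, hX, hY, add_zero]

/-! ### Products with superfunctions -/

theorem smulVF_apply (f : M.O U) (X : M.VF U) (r : ZMod 2) (V : {V // V ≤ U}) :
    (smulVF f X r).1 V = ∑ s, LinearMap.mulLeft ℝ (res V.2 (part s f)) * (X (r - s)).1 V := by
  simp only [smulVF, Submodule.coe_sum, Finset.sum_apply]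
  rfl

theorem sum_sum_sub {A : Type*} [AddCommMonoid A] (F : ZMod 2 → ZMod 2 → A) :
    ∑ r, ∑ s, F s (r - s) = ∑ s, ∑ t, F s t :=
  Finset.sum_comm.trans <| Finset.sum_congr rfl fun s _ => Equiv.sum_comp (Equiv.subRight s) (F s)

theorem toEnd_smulVF (f : M.O U) (X : M.VF U) :
    toEnd (smulVF f X) = LinearMap.mulLeft ℝ f * toEnd X := by
  have hf : LinearMap.mulLeft ℝ f = ∑ s, LinearMap.mulLeft ℝ (part s f) :=
    LinearMap.ext fun g => by
      simp only [LinearMap.sum_apply, LinearMap.mulLeft_apply, ← Finset.sum_mul, sum_part]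
  simp only [toEnd_eq_sum, smulVF_apply, res_self, hf, Finset.sum_mul_sum]
  exact sum_sum_sub fun s t => LinearMap.mulLeft ℝ (part s f) * (X t).1 ⟨U, le_rfl⟩

theorem resVF_smulVF (h : V ≤ U) (f : M.O U) (X : M.VF U) :
    resVF h (smulVF f X) = smulVF (res h f) (resVF h X) :=
  VF.ext fun r W => by simp only [resVF, smulVF_apply, ← res_part, res_res]

instance : SMul (M.O U) (M.VF U) := ⟨smulVF⟩

theorem smulVF_eq_smul (f : M.O U) (X : M.VF U) : smulVF f X = f • X := rfl

theorem resVF_smul (h : V ≤ U) (f : M.O U) (X : M.VF U) :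
    resVF h (f • X) = res h f • resVF h X := resVF_smulVF h f X

theorem toEnd_smul (f : M.O U) (X : M.VF U) (g : M.O U) : toEnd (f • X) g = f * toEnd X g :=
  LinearMap.congr_fun (toEnd_smulVF f X) g

instance : Module (M.O U) (M.VF U) where
  one_smul X := VF.ext_toEnd fun V h => LinearMap.ext fun g => by
    rw [resVF_smul, toEnd_smul, map_one, one_mul]
  mul_smul f g X := VF.ext_toEnd fun V h => LinearMap.ext fun k => by
    simp only [resVF_smul, toEnd_smul, map_mul, mul_assoc]
  smul_zero f := VF.ext_toEnd fun V h => LinearMap.ext fun g => by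
    rw [resVF_smul, toEnd_smul, resVF_zero, map_zero, LinearMap.zero_apply, mul_zero]
  zero_smul X := VF.ext_toEnd fun V h => LinearMap.ext fun g => by
    rw [resVF_smul, toEnd_smul, resVF_zero, map_zero, map_zero, LinearMap.zero_apply, zero_mul]
  smul_add f X Y := VF.ext_toEnd fun V h => LinearMap.ext fun g => by
    simp only [resVF_smul, toEnd_smul, resVF_add, map_add, LinearMap.add_apply, mul_add]
  add_smul f g X := VF.ext_toEnd fun V h => LinearMap.ext fun k => by
    simp only [resVF_smul, toEnd_smul, resVF_add, map_add, LinearMap.add_apply, add_mul]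

instance : IsScalarTower ℝ (M.O U) (M.VF U) where
  smul_assoc c f X := VF.ext_toEnd fun V h => LinearMap.ext fun g => by
    simp only [resVF_smul, resVF_smul_real, map_smul, toEnd_smul, LinearMap.smul_apply,
      smul_mul_assoc]

theorem VFHasParity.smul {f : M.O U} (hf : f ∈ M.parity U a) (hX : VFHasParity X s) :
    VFHasParity (f • X) (a + s) := fun t ht => by
  refine Subtype.ext (funext fun V => ?_)
  rw [← smulVF_eq_smul, smulVF_apply]
  refine Finset.sum_eq_zero fun j _ => ?_
  rw [part_of_mem hf]
  split_ifs with hj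
  · rw [hX (t - j) fun h => ht (by rw [← h, ← hj, add_sub_cancel])]
    exact mul_zero _
  · rw [map_zero, LinearMap.mulLeft_zero_eq_zero, zero_mul]

/-! ### The Lie superbracket -/

theorem bracket_apply (X Y : M.VF U) (r : ZMod 2) (V : {V // V ≤ U}) :
    (bracket X Y r).1 V = ∑ s, ((X s).1 V * (Y (r - s)).1 V
      - koszul s (r - s) • ((Y (r - s)).1 V * (X s).1 V)) := by
  simp only [bracket, Submodule.coe_sum, Finset.sum_apply]
  rfl

theorem resVF_bracket (h : V ≤ U) (X Y : M.VF U) :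
    resVF h (bracket X Y) = bracket (resVF h X) (resVF h Y) :=
  VF.ext fun r W => by simp only [resVF, bracket_apply]

/-- The Lie superbracket, as a bilinear map. -/
def bracketₗ : M.VF U →ₗ[ℝ] M.VF U →ₗ[ℝ] M.VF U :=
  LinearMap.mk₂ ℝ bracket
    (fun X Y Z => VF.ext fun r W => by
      simp only [bracket_apply, Pi.add_apply, Submodule.coe_add, add_mul, mul_add, smul_add,
        ← Finset.sum_add_distrib]
      exact Finset.sum_congr rfl fun s _ => by abel)
    (fun c X Y => VF.ext fun r W => by
      simp only [bracket_apply, Pi.smul_apply, Submodule.coe_smul, smul_mul_assoc, mul_smul_comm,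
        smul_sub, Finset.smul_sum, smul_comm c])
    (fun X Y Z => VF.ext fun r W => by
      simp only [bracket_apply, Pi.add_apply, Submodule.coe_add, add_mul, mul_add, smul_add,
        ← Finset.sum_add_distrib]
      exact Finset.sum_congr rfl fun s _ => by abel)
    (fun c X Y => VF.ext fun r W => by
      simp only [bracket_apply, Pi.smul_apply, Submodule.coe_smul, smul_mul_assoc, mul_smul_comm,
        smul_sub, Finset.smul_sum, smul_comm c])

theorem VFHasParity.bracket (hX : VFHasParity X s) (hY : VFHasParity Y t) :
    VFHasParity (bracket X Y) (s + t) := fun r hr => by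
  refine Subtype.ext (funext fun V => ?_)
  rw [bracket_apply]
  refine Finset.sum_eq_zero fun j _ => ?_
  by_cases hj : j = s
  · rw [hY (r - j) fun h => hr (by rw [← h, hj, add_sub_cancel])]
    simp
  · simp [hX j hj]

theorem toEnd_bracket (hX : VFHasParity X s) (hY : VFHasParity Y t) :
    toEnd (bracket X Y) = toEnd X * toEnd Y - koszul s t • (toEnd Y * toEnd X) := by
  rw [(hX.bracket hY).toEnd_eq, hX.toEnd_eq, hY.toEnd_eq, bracket_apply,
    Fintype.sum_eq_single s fun j hj => by simp [hX j hj], add_sub_cancel_left]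

theorem bracket_smul {f : M.O U} (hX : VFHasParity X s) (hY : VFHasParity Y t)
    (hf : f ∈ M.parity U a) :
    bracket X (f • Y) = toEnd X f • Y + koszul s a • (f • bracket X Y) := by
  refine VF.ext_toEnd fun V h => LinearMap.ext fun g => ?_
  have hXV := hX.resVF h
  have hYV := hY.resVF h
  have hfV := res_mem h hf
  simp only [resVF_bracket, resVF_smul, resVF_add, resVF_smul_real, res_toEnd, map_add, map_smul,
    LinearMap.add_apply, LinearMap.smul_apply, toEnd_smul, toEnd_bracket hXV hYV,
    toEnd_bracket hXV (hYV.smul hfV), LinearMap.sub_apply, Module.End.mul_apply,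
    hXV.toEnd_mul hfV, koszul_add_right, mul_sub, smul_sub, mul_smul_comm, smul_smul]
  abel

theorem bracket_add_left (X Y Z : M.VF U) : bracket (X + Y) Z = bracket X Z + bracket Y Z :=
  bracketₗ.map_add₂ X Y Z

theorem bracket_add_right (X Y Z : M.VF U) : bracket X (Y + Z) = bracket X Y + bracket X Z :=
  (bracketₗ X).map_add Y Z

theorem bracket_comm (hX : VFHasParity X s) (hY : VFHasParity Y t) :
    bracket Y X = (-koszul s t) • bracket X Y := by
  refine VF.ext_toEnd fun V h => LinearMap.ext fun f => ?_
  rw [resVF_smul_real, map_smul, LinearMap.smul_apply, resVF_bracket, resVF_bracket,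
    toEnd_bracket (hY.resVF h) (hX.resVF h), toEnd_bracket (hX.resVF h) (hY.resVF h),
    LinearMap.sub_apply, LinearMap.sub_apply, LinearMap.smul_apply, LinearMap.smul_apply,
    koszul_comm t s, neg_smul, smul_sub, koszul_mul_self_smul, neg_sub]

section Even

variable {N : M.VF U}

theorem toEnd_bracket_of_even (hN : VFHasParity N 0) (X : M.VF U) :
    toEnd (bracket N X) = toEnd N * toEnd X - toEnd X * toEnd N := by
  induction X using VF.induction with
  | hom s X hX => rw [toEnd_bracket hN hX, koszul_zero_left, one_smul]
  | add X Y hX hY =>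
    rw [bracket_add_right, map_add, map_add, hX, hY, mul_add, add_mul, add_sub_add_comm]

theorem toEnd_toEnd_of_even (hN : VFHasParity N 0) (X : M.VF U) (f : M.O U) :
    toEnd N (toEnd X f) = toEnd (bracket N X) f + toEnd X (toEnd N f) := by
  rw [toEnd_bracket_of_even hN, LinearMap.sub_apply, Module.End.mul_apply, Module.End.mul_apply,
    sub_add_cancel]

theorem bracket_bracket_of_even (hN : VFHasParity N 0) (hX : VFHasParity X s)
    (hY : VFHasParity Y t) :
    bracket N (bracket X Y) = bracket (bracket N X) Y + bracket X (bracket N Y) := by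
  have hNX := hN.bracket hX
  have hNY := hN.bracket hY
  rw [zero_add] at hNX hNY
  refine VF.ext_toEnd fun V h => ?_
  have hNV := hN.resVF h
  have hXV := hX.resVF h
  have hYV := hY.resVF h
  have hNXV := hNX.resVF h
  have hNYV := hNY.resVF h
  rw [resVF_bracket] at hNXV hNYV
  simp only [resVF_bracket, resVF_add, map_add, toEnd_bracket_of_even hNV, toEnd_bracket hXV hYV,
    toEnd_bracket hNXV hYV, toEnd_bracket hXV hNYV, mul_sub, sub_mul, mul_smul_comm,
    smul_mul_assoc, smul_sub, mul_assoc]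
  abel

end Even

end VectorFields

/-! ### One-forms -/

namespace OneForm

variable (α : M.OneForm) {s t : ZMod 2} {X Y : M.VF U}

/-- Contraction with `α`, as a linear map over superfunctions. -/
def contrₗ (U : Opens M.carrier) : M.VF U →ₗ[M.O U] M.O U where
  toFun := α.contr
  map_add' := α.contr.map_add
  map_smul' := α.contr_smul

theorem contr_smul_eq_mul (f : M.O U) (X : M.VF U) : α.contr (f • X) = f * α.contr X :=
  α.contr_smul f X

theorem dContr_add_left (X X' Y : M.VF U) :
    α.dContr (X + X') Y = α.dContr X Y + α.dContr X' Y := by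
  simp only [dContr, Pi.add_apply, ofHom, Pi.single_add, act_eq_toEnd, map_add,
    LinearMap.add_apply, bracket_add_left, smul_add, ← Finset.sum_add_distrib]
  exact Finset.sum_congr rfl fun s _ => Finset.sum_congr rfl fun t _ => by abel

theorem dContr_add_right (X Y Y' : M.VF U) :
    α.dContr X (Y + Y') = α.dContr X Y + α.dContr X Y' := by
  simp only [dContr, Pi.add_apply, ofHom, Pi.single_add, act_eq_toEnd, map_add,
    LinearMap.add_apply, bracket_add_right, smul_add, ← Finset.sum_add_distrib]
  exact Finset.sum_congr rfl fun s _ => Finset.sum_congr rfl fun t _ => by abel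

theorem dContr_of_parity (hX : VFHasParity X s) (hY : VFHasParity Y t) :
    α.dContr X Y = koszul s t • toEnd X (α.contr Y) - toEnd Y (α.contr X)
      - koszul s t • α.contr (bracket X Y) := by
  have zero_bracket (Z : M.VF U) : bracket 0 Z = 0 := bracketₗ.map_zero₂ Z
  have bracket_zero (Z : M.VF U) : bracket Z 0 = 0 := (bracketₗ Z).map_zero
  conv_rhs => rw [hX.eq_ofHom, hY.eq_ofHom]
  simp only [dContr, act_eq_toEnd]
  rw [Fintype.sum_eq_single s, Fintype.sum_eq_single t]
  · intro j hj
    simp [hY j hj, ofHom, bracket_zero]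
  · intro j hj
    simp [hX j hj, ofHom, zero_bracket]

theorem dContr_res (h : V ≤ U) (X Y : M.VF U) :
    α.dContr (resVF h X) (resVF h Y) = res h (α.dContr X Y) := by
  induction X using VF.induction with
  | hom s X hX =>
    induction Y using VF.induction with
    | hom t Y hY =>
      simp only [α.dContr_of_parity hX hY, α.dContr_of_parity (hX.resVF h) (hY.resVF h),
        α.contr_res, ← resVF_bracket, map_sub, map_smul, res_toEnd]
    | add Y Z hY hZ => rw [resVF_add, dContr_add_right, dContr_add_right, hY, hZ, map_add]
  | add X Z hX hZ => rw [resVF_add, dContr_add_left, dContr_add_left, hX, hZ, map_add]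

theorem dContr_smul_right (X : M.VF U) (f : M.O U) (Y : M.VF U) :
    α.dContr X (f • Y) = f * α.dContr X Y := by
  induction X using VF.induction with
  | hom s X hX =>
    induction f using O.induction with
    | hom a f hf =>
      induction Y using VF.induction with
      | hom t Y hY =>
        rw [α.dContr_of_parity hX hY, α.dContr_of_parity hX (hY.smul hf), bracket_smul hX hY hf]
        simp only [contr_smul_eq_mul, hX.toEnd_mul hf, toEnd_smul, map_add, map_smul, smul_add,
          mul_sub, mul_smul_comm, koszul_add_right, mul_smul, koszul_mul_self_smul,
          smul_comm (koszul s a) (koszul s t)]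
        abel
      | add Y Z hY hZ => rw [smul_add, dContr_add_right, dContr_add_right, hY, hZ, mul_add]
    | add f g hf hg => rw [add_smul, dContr_add_right, hf, hg, add_mul]
  | add X Z hX hZ => rw [dContr_add_left, dContr_add_left, hX, hZ, mul_add]

theorem dContr_swap (hX : VFHasParity X s) (hY : VFHasParity Y t) :
    α.dContr Y X = -(koszul s t • α.dContr X Y) := by
  rw [α.dContr_of_parity hX hY, α.dContr_of_parity hY hX, bracket_comm hX hY, koszul_comm t s]
  simp only [map_smul, neg_smul, smul_neg, smul_sub, koszul_mul_self_smul]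
  abel

theorem dContr_sum_left {ι : Type*} (T : Finset ι) (F : ι → M.VF U) (Y : M.VF U) :
    α.dContr (∑ k ∈ T, F k) Y = ∑ k ∈ T, α.dContr (F k) Y :=
  map_sum (AddMonoidHom.mk' (α.dContr · Y) fun X X' => α.dContr_add_left X X' Y) F T

/-- The one-form `i_X dα`, i.e. the value at `X` of the morphism `♭_{dα}` from the tangent to the
cotangent sheaf. -/
def flat (X : M.VF U) : M.VF U →ₗ[M.O U] M.O U where
  toFun := α.dContr X
  map_add' := α.dContr_add_right X
  map_smul' := α.dContr_smul_right X

theorem dContr_smul_left (f : M.O U) (X : M.VF U) (hY : VFHasParity Y t) :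
    α.dContr (f • X) Y = twist t f * α.dContr X Y := by
  induction X using VF.induction with
  | hom s X hX =>
    induction f using O.induction with
    | hom a f hf =>
      rw [α.dContr_swap hY (hX.smul hf), dContr_smul_right, α.dContr_swap hX hY, twist_of_mem hf,
        koszul_add_right, koszul_comm t s, koszul_comm t a, mul_neg, smul_neg, neg_neg,
        mul_smul_comm, mul_smul, koszul_mul_self_smul, smul_mul_assoc]
    | add f g hf hg => rw [add_smul, dContr_add_left, hf, hg, map_add, add_mul]
  | add X Z hX hZ => rw [smul_add, dContr_add_left, dContr_add_left, hX, hZ, mul_add]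

/-- The kernel of `dα` over `U`, as a submodule of the vector fields on `U`. -/
def kerD (U : Opens M.carrier) : Submodule (M.O U) (M.VF U) where
  carrier := {X | α.MemKerD X}
  add_mem' {X X'} hX hX' V h Y := by
    rw [resVF_add, dContr_add_left, hX V h, hX' V h, add_zero]
  zero_mem' V h Y := by
    rw [resVF_zero]
    simpa using α.dContr_add_left 0 0 Y
  smul_mem' f X hX V h Y := by
    induction Y using VF.induction with
    | hom t Y hY => rw [resVF_smul, α.dContr_smul_left _ _ hY, hX V h, mul_zero]
    | add Y Z hY hZ => rw [dContr_add_right, hY, hZ, add_zero]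

variable {α}

theorem MemKerD.resVF (hX : α.MemKerD X) (h : V ≤ U) : α.MemKerD (resVF h X) :=
  fun W h' => hX W (h'.trans h)

variable (α) in
/-- The two equations defining the Reeb vector field of a contact form. -/
def IsReeb (X : M.VF U) : Prop := α.contr X = 1 ∧ α.MemKerD X

theorem IsReeb.resVF (hX : α.IsReeb X) (h : V ≤ U) : α.IsReeb (resVF h X) :=
  ⟨by rw [α.contr_res, hX.1, map_one], hX.2.resVF h⟩

/-! ### Parity -/

section Parity

variable {σ : ZMod 2}

theorem HasParity.contr_mem (hσ : α.HasParity σ) (hX : VFHasParity X s) :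
    α.contr X ∈ M.parity U (s + σ) :=
  hX.eq_ofHom ▸ hσ U s (X s)

theorem HasParity.dContr_mem (hσ : α.HasParity σ) (hX : VFHasParity X s) (hY : VFHasParity Y t) :
    α.dContr X Y ∈ M.parity U (s + (t + σ)) := by
  rw [α.dContr_of_parity hX hY]
  refine sub_mem (sub_mem (Submodule.smul_mem _ _ (hX.toEnd_mem (hσ.contr_mem hY))) ?_)
    (Submodule.smul_mem _ _ ?_)
  · exact add_left_comm t s σ ▸ hY.toEnd_mem (hσ.contr_mem hX)
  · exact add_assoc s t σ ▸ hσ.contr_mem (hX.bracket hY)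

theorem HasParity.contr_ofHom (hσ : α.HasParity σ) (X : M.VF U) (s : ZMod 2) :
    α.contr (ofHom s (X s)) = part (s + σ) (α.contr X) := by
  conv_rhs => rw [← sum_ofHom X, map_sum]
  exact (part_sum_of_mem (fun t => hσ U t (X t)) s).symm

theorem HasParity.memKerD_ofHom (hσ : α.HasParity σ) (hX : α.MemKerD X) (s : ZMod 2) :
    α.MemKerD (ofHom s (X s)) := fun V h Y => by
  rw [resVF_ofHom]
  induction Y using VF.induction with
  | hom t Y hY =>
    have hmem (s : ZMod 2) := hσ.dContr_mem (VFHasParity.ofHom (SuperSpace.resVF h X s)) hY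
    rw [← part_sum_of_mem hmem s, ← dContr_sum_left, sum_ofHom, hX V h Y]
    exact map_zero (GradedRing.proj (M.parity V) _)
  | add Y Z hY hZ => rw [dContr_add_right, hY, hZ, add_zero]

theorem HasParity.isReeb_ofHom (hσ : α.HasParity σ) (hX : α.IsReeb X) :
    α.IsReeb (ofHom σ (X σ)) := by
  refine ⟨?_, hσ.memKerD_ofHom hX.2 σ⟩
  rw [hσ.contr_ofHom, hX.1, CharTwo.add_self_eq_zero, part_of_mem one_mem_parity, if_pos rfl]

end Parity

/-! ### Weight -/

section Weight

variable {N : M.HomVF ⊤ 0} {w : ℝ}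

theorem HasWeight.toEnd_contr (hw : α.HasWeight N w) (X : M.VF U) :
    toEnd (SuperSpace.resVF le_top (ofHom 0 N)) (α.contr X) =
      w • α.contr X + α.contr (bracket (SuperSpace.resVF le_top (ofHom 0 N)) X) :=
  act_eq_toEnd (SuperSpace.resVF le_top (ofHom 0 N)) _ ▸ sub_eq_iff_eq_add.1 (hw U X)

theorem HasWeight.toEnd_dContr (hw : α.HasWeight N w) (X Y : M.VF U) :
    toEnd (SuperSpace.resVF le_top (ofHom 0 N)) (α.dContr X Y) = w • α.dContr X Y +
      (α.dContr (bracket (SuperSpace.resVF le_top (ofHom 0 N)) X) Y +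
        α.dContr X (bracket (SuperSpace.resVF le_top (ofHom 0 N)) Y)) := by
  have hNU : VFHasParity (SuperSpace.resVF (le_top : U ≤ ⊤) (ofHom 0 N)) 0 :=
    (VFHasParity.ofHom N).resVF _
  have hcontr := hw.toEnd_contr (U := U)
  generalize SuperSpace.resVF (le_top : U ≤ ⊤) (ofHom 0 N) = N at hNU hcontr ⊢
  induction X using VF.induction with
  | hom s X hX =>
    induction Y using VF.induction with
    | hom t Y hY =>
      have hNX : VFHasParity (bracket N X) s := by simpa using hNU.bracket hX
      have hNY : VFHasParity (bracket N Y) t := by simpa using hNU.bracket hY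
      simp only [α.dContr_of_parity hX hY, α.dContr_of_parity hNX hY, α.dContr_of_parity hX hNY,
        map_sub, map_smul, map_add, hcontr, toEnd_toEnd_of_even hNU,
        bracket_bracket_of_even hNU hX hY, smul_add, smul_sub, smul_comm w]
      abel
    | add Y Z hY hZ =>
      simp only [bracket_add_right, dContr_add_right, map_add, hY, hZ, smul_add]
      abel
  | add X Z hX hZ =>
    simp only [bracket_add_right, dContr_add_left, map_add, hX, hZ, smul_add]
    abel

theorem HasWeight.memKerD_bracket (hw : α.HasWeight N w) (hX : α.MemKerD X) :
    α.MemKerD (bracket (SuperSpace.resVF le_top (ofHom 0 N)) X) := fun V h Y => by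
  simpa [hX V h, resVF_bracket, resVF_resVF] using
    (hw.toEnd_dContr (SuperSpace.resVF h X) Y).symm

end Weight

end OneForm

/-! ### Local stalks, frames and the kernel of `dα` -/

section Frames

variable (M) in
/-- The stalks of `M` are local rings: the superfunctions on a neighbourhood of `m` whose germs at
`m` are not invertible form a two-sided ideal. -/
def HasLocalStalks : Prop :=
  ∀ (m : M.carrier) (U : Opens M.carrier), m ∈ U →
    ∃ I : TwoSidedIdeal (M.O U), ∀ f, f ∈ I ↔ FunVanishesAt f m

theorem HasLocalStalks.zero (hM : M.HasLocalStalks) {m : M.carrier} (hm : m ∈ U) :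
    FunVanishesAt (0 : M.O U) m := by
  obtain ⟨I, hI⟩ := hM m U hm
  exact (hI 0).1 I.zero_mem

theorem not_funVanishesAt_one {m : M.carrier} (hm : m ∈ U) : ¬ FunVanishesAt (1 : M.O U) m :=
  fun h => h U le_rfl hm (by rw [map_one]; exact isUnit_one)

theorem VFVanishesAt.exists_map (hM : M.HasLocalStalks) {m : M.carrier} {X : M.VF U}
    (hX : VFVanishesAt X m) :
    ∃ (V : Opens M.carrier) (h : V ≤ U), m ∈ V ∧
      ∀ φ : M.VF V →ₗ[M.O V] M.O V, FunVanishesAt (φ (resVF h X)) m := by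
  obtain ⟨V, h, k, f, Y, hm, hf, hX⟩ := hX
  refine ⟨V, h, hm, fun φ => ?_⟩
  obtain ⟨I, hI⟩ := hM m V hm
  simp only [hX, smulVF_eq_smul, map_sum, map_smul, smul_eq_mul, ← hI]
  exact sum_mem fun i _ => I.mul_mem_right _ _ ((hI _).2 (hf i))

/-- The restriction of a frame over `U` to `V ≤ U`, as a basis of the module of vector fields. -/
def IsFrame.basis {n : ℕ} {X : Fin n → M.VF U} (hX : IsFrame X) (h : V ≤ U) :
    Module.Basis (Fin n) (M.O V) (M.VF V) :=
  .ofEquivFun <| .symm <| .ofBijective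
    (Fintype.linearCombination (M.O V) fun i => resVF h (X i))
    ((Function.bijective_iff_existsUnique _).2 fun Z => by
      simpa only [Fintype.linearCombination_apply, smulVF_eq_smul, eq_comm] using hX.2 V h Z)

theorem IsFrame.basis_apply {n : ℕ} {X : Fin n → M.VF U} (hX : IsFrame X) (h : V ≤ U)
    (i : Fin n) : hX.basis h i = resVF h (X i) := by
  simp [basis, Fintype.linearCombination_apply_single]

theorem IsFrame.not_vfVanishesAt (hM : M.HasLocalStalks) {n : ℕ} {X : Fin n → M.VF U}
    (hX : IsFrame X) (i : Fin n) (m : M.carrier) : ¬ VFVanishesAt (X i) m := by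
  intro hXi
  obtain ⟨V, h, hm, hφ⟩ := hXi.exists_map hM
  have hcoord := hφ ((hX.basis h).coord i)
  rw [← hX.basis_apply h, Module.Basis.coord_apply, Module.Basis.repr_self,
    Finsupp.single_eq_same] at hcoord
  exact not_funVanishesAt_one hm hcoord

namespace OneForm

variable {α : M.OneForm}

theorem IsReeb.not_vfVanishesAt (hM : M.HasLocalStalks) {R : M.VF U} (hR : α.IsReeb R)
    (m : M.carrier) : ¬ VFVanishesAt R m := by
  intro hRm
  obtain ⟨V, h, hm, hφ⟩ := hRm.exists_map hM
  exact not_funVanishesAt_one hm ((hR.resVF h).1 ▸ hφ (α.contrₗ V))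

section Frame

variable {n r : ℕ} {X Y : Fin n → M.VF U} (hX : IsFrame X) (hY : IsFrame Y)
  (hXY : ∀ i j, α.dContr (X i) (Y j) = if i = j ∧ (i : ℕ) < r then 1 else 0)

include hY hXY in
theorem memKerD_frame {i : Fin n} (hi : r ≤ i) : α.MemKerD (X i) := by
  intro V h
  suffices hflat : α.flat (SuperSpace.resVF h (X i)) = 0 from LinearMap.congr_fun hflat
  refine (hY.basis h).ext fun j => ?_
  rw [hY.basis_apply, LinearMap.zero_apply]
  change α.dContr _ _ = 0
  rw [α.dContr_res, hXY, if_neg fun hij => hij.2.not_ge hi, map_zero]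

include hX hY hXY in
theorem kerD_eq_span (h : V ≤ U) :
    α.kerD V = Submodule.span (M.O V) ((fun i => SuperSpace.resVF h (X i)) '' {i | r ≤ i}) := by
  refine le_antisymm (fun Z hZ => ?_) (Submodule.span_le.2 ?_)
  · have hcoord (j : Fin n) (hj : (j : ℕ) < r) : (hX.basis h).repr Z j = 0 := by
      obtain ⟨t, ht⟩ := hY.1 j
      have hdZ : α.dContr Z (SuperSpace.resVF h (Y j)) = 0 := hZ V le_rfl _
      rw [← (hX.basis h).sum_repr Z, dContr_sum_left, Finset.sum_eq_single j] at hdZ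
      · rwa [hX.basis_apply, α.dContr_smul_left _ _ (ht.resVF h), α.dContr_res, hXY,
          if_pos ⟨rfl, hj⟩, map_one, mul_one, ← map_zero (twist t),
          (twist_injective t).eq_iff] at hdZ
      · intro i _ hij
        rw [hX.basis_apply, α.dContr_smul_left _ _ (ht.resVF h), α.dContr_res, hXY,
          if_neg fun hij' => hij hij'.1, map_zero, mul_zero]
      · simp
    rw [← (hX.basis h).sum_repr Z]
    refine sum_mem fun j _ => ?_
    rcases lt_or_ge (j : ℕ) r with hj | hj
    · rw [hcoord j hj, zero_smul]
      exact zero_mem _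
    · rw [hX.basis_apply]
      exact Submodule.smul_mem _ _ (Submodule.subset_span ⟨j, hj, rfl⟩)
  · rintro _ ⟨i, hi, rfl⟩
    exact (memKerD_frame hY hXY hi).resVF h

end Frame

theorem exists_kerD_eq_span_singleton {r : ℕ} (hr : α.DHasRank (r + 1) r)
    (hM : M.HasLocalStalks) (m : M.carrier) :
    ∃ (U : Opens M.carrier) (X : M.VF U), m ∈ U ∧ ¬ VFVanishesAt X m ∧
      ∀ (V : Opens M.carrier) (h : V ≤ U),
        α.kerD V = Submodule.span (M.O V) {SuperSpace.resVF h X} := by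
  obtain ⟨U, X, Y, hm, hX, hY, hXY⟩ := hr.2 m
  refine ⟨U, X (Fin.last r), hm, hX.not_vfVanishesAt hM _ m, fun V h => ?_⟩
  have hlast : {i : Fin (r + 1) | r ≤ i} = {Fin.last r} := by
    ext i
    simp only [Set.mem_ofPred_eq, Set.mem_singleton_iff, Fin.ext_iff, Fin.val_last]
    omega
  rw [kerD_eq_span hX hY hXY h, hlast, Set.image_singleton]

theorem exists_isReeb_nhds {r : ℕ} (hα : α.IsNondegenerate) (hr : α.DHasRank (r + 1) r)
    (hM : M.HasLocalStalks) (m : M.carrier) :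
    ∃ U : Opens M.carrier, m ∈ U ∧ (∃ R : M.VF U, α.IsReeb R) ∧
      ∀ V ≤ U, Set.InjOn α.contr {Z : M.VF V | α.MemKerD Z} := by
  obtain ⟨U, X, hm, hXm, hX⟩ := exists_kerD_eq_span_singleton hr hM m
  have hXker : α.MemKerD X := (hX U le_rfl).ge (Submodule.mem_span_singleton_self _)
  have hunit : ¬ FunVanishesAt (α.contr X) m := fun hXα =>
    hXm (hα m U X hm ⟨hXα, fun V h hV Y => (hXker V h Y).symm ▸ hM.zero hV⟩)
  simp only [FunVanishesAt, not_forall, not_not] at hunit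
  obtain ⟨V, h, hmV, a, ha⟩ := hunit
  refine ⟨V, hmV, ⟨(↑a⁻¹ : M.O V) • SuperSpace.resVF h X, ?_,
    (α.kerD V).smul_mem _ (hXker.resVF h)⟩, fun W hW Z hZ Z' hZ' hZZ' => ?_⟩
  · rw [α.contr_smul_eq_mul, α.contr_res, ← ha, Units.inv_mul]
  · obtain ⟨c, rfl⟩ := Submodule.mem_span_singleton.1 ((hX W (hW.trans h)).le hZ)
    obtain ⟨c', rfl⟩ := Submodule.mem_span_singleton.1 ((hX W (hW.trans h)).le hZ')
    have haW : IsUnit (SuperSpace.res (hW.trans h) (α.contr X)) := by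
      rw [← res_res h hW, ← ha]
      exact a.isUnit.map _
    rw [α.contr_smul_eq_mul, α.contr_smul_eq_mul, α.contr_res] at hZZ'
    rw [haW.mul_right_cancel hZZ']

end OneForm

end Frames

/-! ### Gluing -/

section Gluing

variable {ι : Type*} {C : ι → Opens M.carrier}

theorem O.eq_of_cover (hC : ∀ i, C i ≤ V) (hV : V ≤ ⨆ i, C i) {f g : M.O V}
    (h : ∀ i, res (hC i) f = res (hC i) g) : f = g :=
  M.sheaf.eq_of_locally_eq' C V (fun i => homOfLE (hC i)) hV f g h

theorem O.exists_glue (hC : ∀ i, C i ≤ V) (hV : V ≤ ⨆ i, C i) (f : ∀ i, M.O (C i))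
    (h : ∀ i j, res (inf_le_left : C i ⊓ C j ≤ C i) (f i) = res inf_le_right (f j)) :
    ∃ g : M.O V, ∀ i, res (hC i) g = f i :=
  (M.sheaf.existsUnique_gluing' C V (fun i => homOfLE (hC i)) hV f h).exists

theorem O.exists_glue_linearMap {A : Type*} [AddCommGroup A] [Module ℝ A] (hC : ∀ i, C i ≤ V)
    (hV : V ≤ ⨆ i, C i) (L : ∀ i, A →ₗ[ℝ] M.O (C i))
    (h : ∀ i j a, res (inf_le_left : C i ⊓ C j ≤ C i) (L i a) = res inf_le_right (L j a)) :
    ∃ G : A →ₗ[ℝ] M.O V, ∀ i a, res (hC i) (G a) = L i a := by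
  choose G hG using fun a => O.exists_glue hC hV (fun i => L i a) fun i j => h i j a
  refine ⟨{ toFun := G, map_add' := fun a b => ?_, map_smul' := fun c a => ?_ }, fun i a => hG a i⟩
  · exact O.eq_of_cover hC hV fun i => by simp only [map_add, hG]
  · exact O.eq_of_cover hC hV fun i => by simp only [map_smul, hG, RingHom.id_apply]

variable (hC : ∀ i, C i ≤ U) (hU : U ≤ ⨆ i, C i)

include hU in
theorem le_iSup_inf_of_le (h : V ≤ U) : V ≤ ⨆ i, V ⊓ C i :=
  (le_inf le_rfl (h.trans hU)).trans (inf_iSup_eq V C).le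

theorem HomVF.res_apply {s : ZMod 2} (D : M.HomVF U s) (hV : V ≤ U) (h : W ≤ V) (f : M.O V) :
    res h (D.1 ⟨V, hV⟩ f) = D.1 ⟨W, h.trans hV⟩ (res h f) :=
  D.2.1 ⟨V, hV⟩ ⟨W, h.trans hV⟩ h f

include hU in
theorem VF.eq_of_cover {X Y : M.VF U} (h : ∀ i, resVF (hC i) X = resVF (hC i) Y) : X = Y := by
  refine VF.ext fun r W => LinearMap.ext fun f => ?_
  refine O.eq_of_cover (fun i => inf_le_left) (le_iSup_inf_of_le hU W.2) fun i => ?_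
  rw [HomVF.res_apply, HomVF.res_apply]
  exact congrArg (fun Z : M.VF (C i) => (Z r).1 ⟨W.1 ⊓ C i, inf_le_right⟩ (res inf_le_left f)) (h i)

include hU in
theorem HomVF.exists_glue {s : ZMod 2} (D : ∀ i, M.HomVF (C i) s)
    (h : ∀ (i j : ι) (W : Opens M.carrier) (hi : W ≤ C i) (hj : W ≤ C j),
      (D i).1 ⟨W, hi⟩ = (D j).1 ⟨W, hj⟩) :
    ∃ E : M.HomVF U s, ∀ i (W : Opens M.carrier) (hi : W ≤ C i) (hW : W ≤ U),
      E.1 ⟨W, hW⟩ = (D i).1 ⟨W, hi⟩ := by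
  have hcover (V : {V // V ≤ U}) : V.1 ≤ ⨆ i, V.1 ⊓ C i := le_iSup_inf_of_le hU V.2
  have hglue (V : {V // V ≤ U}) : ∃ G : M.O V.1 →ₗ[ℝ] M.O V.1, ∀ i f,
      res (inf_le_left : V.1 ⊓ C i ≤ V.1) (G f) =
        (D i).1 ⟨V.1 ⊓ C i, inf_le_right⟩ (res inf_le_left f) := by
    refine O.exists_glue_linearMap (fun i => inf_le_left) (hcover V)
      (fun i => (D i).1 ⟨V.1 ⊓ C i, inf_le_right⟩ ∘ₗ (res inf_le_left).toLinearMap) fun i j f => ?_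
    simp only [LinearMap.comp_apply, AlgHom.toLinearMap_apply]
    rw [HomVF.res_apply, HomVF.res_apply, res_res, res_res, h i j]
  choose G hG using hglue
  have hGeq {V : {V // V ≤ U}} {f g : M.O V.1}
      (hfg : ∀ i, res (inf_le_left : V.1 ⊓ C i ≤ V.1) f = res inf_le_left g) : f = g :=
    O.eq_of_cover (fun i => inf_le_left) (hcover V) hfg
  refine ⟨⟨G, fun V W hWV f => hGeq fun i => ?_, fun V a f hf => ?_, fun V a f g hf => ?_⟩,
    fun i W hi hW => LinearMap.ext fun f => hGeq (V := ⟨W, hW⟩) fun j => ?_⟩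
  · rw [hG, res_res, res_res, ← res_res inf_le_left (inf_le_inf_right (C i) hWV), hG,
      HomVF.res_apply, res_res]
  · suffices part (s + a) (G V f) = G V f from this ▸ part_mem _ _
    refine hGeq fun i => ?_
    rw [res_part, hG, part_of_mem ((D i).2.2.1 _ a _ (res_mem _ hf)), if_pos rfl]
  · refine hGeq fun i => ?_
    rw [hG, map_mul, (D i).2.2.2 _ a _ _ (res_mem _ hf)]
    simp only [map_add, map_mul, map_smul, hG]
  · rw [hG, h j i _ _ (inf_le_left.trans hi)]
    exact ((D i).2.1 ⟨W, hi⟩ ⟨_, inf_le_left.trans hi⟩ inf_le_left f).symm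

include hU in
theorem VF.exists_glue (X : ∀ i, M.VF (C i))
    (h : ∀ i j, resVF (inf_le_left : C i ⊓ C j ≤ C i) (X i) = resVF inf_le_right (X j)) :
    ∃ Y : M.VF U, ∀ i, resVF (hC i) Y = X i := by
  have hs (s : ZMod 2) := HomVF.exists_glue hU (fun i => X i s) fun i j W hi hj =>
    congrArg (fun Z : M.VF (C i ⊓ C j) => (Z s).1 ⟨W, le_inf hi hj⟩) (h i j)
  choose E hE using hs
  exact ⟨E, fun i => VF.ext fun s W => hE s i W.1 W.2 _⟩

namespace OneForm

variable {α : M.OneForm}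

include hU in
theorem MemKerD.of_cover {X : M.VF U} (hX : ∀ i, α.MemKerD (SuperSpace.resVF (hC i) X)) :
    α.MemKerD X := fun V h Y => by
  refine O.eq_of_cover (fun i => inf_le_left) (le_iSup_inf_of_le hU h) fun i => ?_
  rw [← α.dContr_res, map_zero]
  exact hX i (V ⊓ C i) inf_le_right _

include hU in
theorem IsReeb.of_cover {X : M.VF U} (hX : ∀ i, α.IsReeb (SuperSpace.resVF (hC i) X)) :
    α.IsReeb X := by
  refine ⟨O.eq_of_cover hC hU fun i => ?_, .of_cover hC hU fun i => (hX i).2⟩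
  rw [← α.contr_res, map_one, (hX i).1]

end OneForm

end Gluing

/-! ### The Reeb vector field -/

namespace OneForm

section Reeb

variable {α : M.OneForm} {r : ℕ} (hα : α.IsNondegenerate) (hr : α.DHasRank (r + 1) r)
  (hM : M.HasLocalStalks)

include hα hr hM

theorem eq_of_contr_eq {X Y : M.VF U} (hX : α.MemKerD X) (hY : α.MemKerD Y)
    (h : α.contr X = α.contr Y) : X = Y := by
  choose C hmC _ hC using exists_isReeb_nhds hα hr hM
  refine VF.eq_of_cover (C := fun m => U ⊓ C m) (fun m => inf_le_left)
    (fun m hm => Opens.mem_iSup.2 ⟨m, hm, hmC m⟩) fun m => ?_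
  exact hC m (U ⊓ C m) inf_le_right (hX.resVF _) (hY.resVF _)
    (by rw [α.contr_res, α.contr_res, h])

theorem IsReeb.eq {X Y : M.VF U} (hX : α.IsReeb X) (hY : α.IsReeb Y) : X = Y :=
  eq_of_contr_eq hα hr hM hX.2 hY.2 (hX.1.trans hY.1.symm)

theorem exists_isReeb : ∃ R : M.VF ⊤, α.IsReeb R := by
  choose C hmC hC _ using exists_isReeb_nhds hα hr hM
  choose R hR using hC
  obtain ⟨Y, hY⟩ := VF.exists_glue (U := ⊤) (fun _ => le_top)
    (fun m _ => Opens.mem_iSup.2 ⟨m, hmC m⟩) R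
    fun m m' => ((hR m).resVF _).eq hα hr hM ((hR m').resVF _)
  exact ⟨Y, .of_cover (fun _ => le_top) (fun m _ => Opens.mem_iSup.2 ⟨m, hmC m⟩)
    fun m => hY m ▸ hR m⟩

theorem IsReeb.hasParity {σ : ZMod 2} (hσ : α.HasParity σ) {R : M.VF U} (hR : α.IsReeb R) :
    VFHasParity R σ :=
  hR.eq hα hr hM (hσ.isReeb_ofHom hR) ▸ VFHasParity.ofHom _

theorem IsReeb.hasWeight {N : M.HomVF ⊤ 0} {w : ℝ} (hw : α.HasWeight N w) {R : M.VF ⊤}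
    (hR : α.IsReeb R) : VFHasWeight N R (-w) := by
  refine eq_of_contr_eq hα hr hM (hw.memKerD_bracket hR.2)
    ((α.kerD ⊤).smul_of_tower_mem (-w) hR.2) ?_
  have hcontr := hw.toEnd_contr R
  rw [hR.1, toEnd_one] at hcontr
  rw [map_smul, hR.1, neg_smul]
  exact (neg_eq_of_add_eq_zero_right hcontr.symm).symm

end Reeb

end OneForm

end SuperSpace

/-! ### Superfunctions on `ℝ^{p|q}` -/

section Model

theorem isNilpotent_of_decompose_zero_eq_zero {A σ : Type*} [Semiring A] [SetLike σ A]
    [AddSubmonoidClass σ A] (𝒜 : ℕ → σ) [GradedRing 𝒜] {n : ℕ}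
    (h𝒜 : ∀ i, n < i → ∀ a ∈ 𝒜 i, a = 0) {a : A} (ha : DirectSum.decompose 𝒜 a 0 = 0) :
    IsNilpotent a := by
  refine ⟨n + 1, (DirectSum.decompose 𝒜).injective ?_⟩
  change DirectSum.decomposeRingEquiv 𝒜 (a ^ (n + 1)) = DirectSum.decomposeRingEquiv 𝒜 0
  rw [map_pow, map_zero, ← List.prod_replicate]
  refine DFinsupp.ext fun i => ?_
  rcases Nat.lt_or_ge n i with hi | hi
  · exact Subtype.ext ((h𝒜 i hi _ (SetLike.coe_mem _)).trans (h𝒜 i hi _ (SetLike.coe_mem _)).symm)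
  · rw [listProd_apply_eq_zero (m := 1)]
    · simp
    · intro b hb k hk
      rw [List.eq_of_mem_replicate hb, Nat.lt_one_iff.1 hk]
      exact ha
    · simpa using Nat.lt_succ_of_le hi

theorem exteriorPower_eq_bot {K E : Type*} [Field K] [AddCommGroup E] [Module K E]
    [FiniteDimensional K E] {n : ℕ} (hn : Module.finrank K E < n) : ⋀[K]^n E = ⊥ := by
  rw [← Submodule.finrank_eq_zero (R := K), exteriorPower.finrank_eq, Nat.choose_eq_zero_of_lt hn]

theorem algebraMapInv_eq_zero_of_mem_exteriorPower {R E : Type*} [CommRing R] [AddCommGroup E]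
    [Module R E] {n : ℕ} (hn : n ≠ 0) {a : ExteriorAlgebra R E} (ha : a ∈ ⋀[R]^n E) :
    ExteriorAlgebra.algebraMapInv a = 0 := by
  obtain ⟨n, rfl⟩ := Nat.exists_eq_succ_of_ne_zero hn
  rw [ExteriorAlgebra.exteriorPower, pow_succ'] at ha
  induction ha using Submodule.mul_induction_on' with
  | mem_mul_mem v hv b _ =>
    obtain ⟨v, rfl⟩ := hv
    simp [ExteriorAlgebra.algebraMapInv]
  | add a _ b _ ha hb => rw [map_add, ha, hb, add_zero]

variable {p q : ℕ} {V W : Opens (EuclideanSpace ℝ (Fin p))}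

/-- The body of a superfunction on `ℝ^{p|q}`: the smooth function obtained by setting the odd
coordinates to zero. -/
def body : Model q V →ₐ[ℝ] Smooth V :=
  (Algebra.TensorProduct.rid ℝ ℝ (Smooth V)).toAlgHom.comp
    (Algebra.TensorProduct.map (AlgHom.id ℝ (Smooth V)) ExteriorAlgebra.algebraMapInv)

theorem body_tmul (f : Smooth V) (a : Grassmann q) :
    body (f ⊗ₜ a) = ExteriorAlgebra.algebraMapInv a • f := by
  simp [body]

theorem body_modelRes (h : W ≤ V) (x : Model q V) :
    body (modelRes q h x) = smoothRes h (body x) := by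
  induction x using TensorProduct.induction_on with
  | zero => simp only [map_zero]
  | add x y hx hy => simp only [map_add, hx, hy]
  | tmul f a =>
    rw [modelRes, Algebra.TensorProduct.map_tmul, body_tmul, body_tmul, map_smul, AlgHom.id_apply]

/-- The superfunctions on `ℝ^{p|q}` which are of degree `k` in the odd coordinates. -/
abbrev modelDegree (q : ℕ) (V : Opens (EuclideanSpace ℝ (Fin p))) (k : ℕ) :
    Submodule (Smooth V) (Model q V) :=
  (⋀[ℝ]^k (Fin q → ℝ)).baseChange (Smooth V)

theorem decompose_sub_body (x : Model q V) :
    DirectSum.decompose (modelDegree q V) (x - body x ⊗ₜ 1) 0 = 0 := by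
  induction x using TensorProduct.induction_on with
  | zero => simp
  | add x y hx hy =>
    rw [map_add, TensorProduct.add_tmul, add_sub_add_comm, DirectSum.decompose_add,
      DirectSum.add_apply, hx, hy, add_zero]
  | tmul f a =>
    rw [body_tmul]
    induction a using DirectSum.Decomposition.inductionOn (fun k => ⋀[ℝ]^k (Fin q → ℝ)) with
    | zero => simp
    | add a b ha hb =>
      rw [map_add, add_smul, TensorProduct.add_tmul, TensorProduct.tmul_add, add_sub_add_comm,
        DirectSum.decompose_add, DirectSum.add_apply, ha, hb, add_zero]
    | @homogeneous k a =>
      rcases eq_or_ne k 0 with rfl | hk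
      · obtain ⟨a, ha⟩ := a
        rw [ExteriorAlgebra.exteriorPower, pow_zero] at ha
        obtain ⟨c, rfl⟩ := Submodule.mem_one.1 ha
        simp [Algebra.algebraMap_eq_smul_one, TensorProduct.smul_tmul]
      · have hfa := Submodule.tmul_mem_baseChange_of_mem f a.2
        rw [algebraMapInv_eq_zero_of_mem_exteriorPower hk a.2, zero_smul, TensorProduct.zero_tmul,
          sub_zero]
        exact Subtype.ext (DirectSum.decompose_of_mem_ne (modelDegree q V) hfa hk)

theorem isNilpotent_sub_body (x : Model q V) : IsNilpotent (x - body x ⊗ₜ 1) := by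
  refine isNilpotent_of_decompose_zero_eq_zero (modelDegree q V) (n := q) (fun k hk a ha => ?_)
    (decompose_sub_body x)
  rwa [modelDegree, exteriorPower_eq_bot (by simpa using hk), Submodule.baseChange_bot,
    Submodule.mem_bot] at ha

theorem isUnit_of_isUnit_body {x : Model q V} (h : IsUnit (body x)) : IsUnit x := by
  have hcomm : Commute (x - body x ⊗ₜ 1) (body x ⊗ₜ[ℝ] (1 : Grassmann q)) :=
    (Algebra.commutes (A := Model q V) (body x) _).symm
  simpa using (isNilpotent_sub_body x).isUnit_add_left_of_commute
    (h.map (Algebra.TensorProduct.includeLeft : Smooth V →ₐ[ℝ] Model q V)) hcomm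

theorem Smooth.isUnit_of_ne_zero {f : Smooth V} (h : ∀ v, f v ≠ 0) : IsUnit f :=
  IsUnit.of_mul_eq_one ⟨fun v => (f v)⁻¹, f.contMDiff.inv₀ h⟩ <|
    ContMDiffMap.ext fun v => mul_inv_cancel₀ (h v)

/-- The value of a superfunction on an open part of `ℝ^{p|q}` at a point. -/
def modelEval (y : V) : Model q V →+* ℝ :=
  (ContMDiffMap.evalRingHom y : Smooth V →+* ℝ).comp (body : Model q V →ₐ[ℝ] Smooth V)

theorem modelEval_modelRes (h : W ≤ V) (y : W) (x : Model q V) :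
    modelEval y (modelRes q h x) = modelEval ⟨y, h y.2⟩ x :=
  congrArg (fun f : Smooth W => f y) (body_modelRes h x)

theorem exists_isUnit_modelRes {y : V} {x : Model q V} (hxy : modelEval y x ≠ 0) :
    ∃ (W : Opens (EuclideanSpace ℝ (Fin p))) (h : W ≤ V), y.1 ∈ W ∧ IsUnit (modelRes q h x) := by
  have hopen : IsOpen {v : V | body x v ≠ 0} :=
    isOpen_ne_fun (body x).contMDiff.continuous continuous_const
  let W : Opens (EuclideanSpace ℝ (Fin p)) := ⟨_, V.2.isOpenMap_subtype_val _ hopen⟩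
  have hW : W ≤ V := by
    rintro _ ⟨v, -, rfl⟩
    exact v.2
  refine ⟨W, hW, ⟨y, hxy, rfl⟩, isUnit_of_isUnit_body ?_⟩
  rw [body_modelRes]
  refine Smooth.isUnit_of_ne_zero ?_
  rintro ⟨_, v, hv, rfl⟩
  exact hv

end Model

/-! ### Charts -/

namespace Chart

variable {M : SuperSpace.{u}} {p q : ℕ} (c : Chart M p q)

/-- The image of an open set under a chart. -/
def image (U : Opens M.carrier) : Opens (EuclideanSpace ℝ (Fin p)) :=
  ⟨c.homeo.target ∩ c.homeo.symm ⁻¹' U, c.homeo.symm.isOpen_inter_preimage U.2⟩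

/-- The preimage of an open set under a chart. -/
def preimage (V : Opens (EuclideanSpace ℝ (Fin p))) : Opens M.carrier :=
  ⟨c.homeo.source ∩ c.homeo ⁻¹' V, c.homeo.isOpen_inter_preimage V.2⟩

variable {U V : Opens M.carrier}

theorem image_subset_target (U : Opens M.carrier) : (c.image U : Set _) ⊆ c.homeo.target :=
  Set.inter_subset_left

theorem image_mono (h : V ≤ U) : c.image V ≤ c.image U := fun _ hy => ⟨hy.1, h hy.2⟩

theorem preimage_mono {V W : Opens (EuclideanSpace ℝ (Fin p))} (h : W ≤ V) :
    c.preimage W ≤ c.preimage V := fun _ hx => ⟨hx.1, h hx.2⟩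

theorem preimage_image_le (U : Opens M.carrier) : c.preimage (c.image U) ≤ U := by
  rintro x ⟨hx, -, hx'⟩
  rwa [Set.mem_preimage, c.homeo.left_inv hx] at hx'

theorem mem_image {m : M.carrier} (hm : m ∈ c.homeo.source) (hU : m ∈ U) :
    c.homeo m ∈ c.image U :=
  ⟨c.homeo.map_source hm, by rwa [Set.mem_preimage, c.homeo.left_inv hm]⟩

/-- The expression of a superfunction in the coordinates of a chart. -/
def expr (U : Opens M.carrier) : M.O U →ₐ[ℝ] Model q (c.image U) :=
  (c.iso (c.image U) (c.image_subset_target U)).symm.toAlgHom.comp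
    (SuperSpace.res (c.preimage_image_le U))

theorem iso_expr (f : M.O U) :
    c.iso (c.image U) (c.image_subset_target U) (c.expr U f) =
      SuperSpace.res (c.preimage_image_le U) f :=
  (c.iso (c.image U) (c.image_subset_target U)).apply_symm_apply _

theorem iso_modelRes_expr {W : Opens (EuclideanSpace ℝ (Fin p))} (hW : W ≤ c.image U)
    (f : M.O U) :
    c.iso W (subset_trans (SetLike.coe_subset_coe.2 hW) (c.image_subset_target U))
        (modelRes q hW (c.expr U f)) =
      SuperSpace.res ((c.preimage_mono hW).trans (c.preimage_image_le U)) f := by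
  rw [← c.iso_res _ _ (c.image_subset_target U), iso_expr]
  exact SuperSpace.res_res _ (c.preimage_mono hW) f

theorem expr_res (h : V ≤ U) (f : M.O U) :
    c.expr V (SuperSpace.res h f) = modelRes q (c.image_mono h) (c.expr U f) := by
  apply (c.iso (c.image V) (c.image_subset_target V)).injective
  rw [iso_expr, iso_modelRes_expr, SuperSpace.res_res]

/-- The value at a point of a superfunction, computed in a chart. -/
def eval {m : M.carrier} (hm : m ∈ c.homeo.source) (hU : m ∈ U) : M.O U →+* ℝ :=
  (modelEval ⟨c.homeo m, c.mem_image hm hU⟩).comp (c.expr U : M.O U →+* Model q (c.image U))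

theorem eval_res {m : M.carrier} (hm : m ∈ c.homeo.source) (h : V ≤ U) (hV : m ∈ V) (f : M.O U) :
    c.eval hm hV (SuperSpace.res h f) = c.eval hm (h hV) f :=
  (congrArg (modelEval _) (c.expr_res h f)).trans (modelEval_modelRes _ _ _)

theorem eval_eq_zero_iff {m : M.carrier} (hm : m ∈ c.homeo.source) (hU : m ∈ U) (f : M.O U) :
    c.eval hm hU f = 0 ↔ SuperSpace.FunVanishesAt f m := by
  refine ⟨fun hf V h hV hunit => ?_, fun hf => by_contra fun hne => ?_⟩
  · have hf' := (hunit.map (c.eval hm hV)).ne_zero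
    rw [eval_res] at hf'
    exact hf' hf
  · obtain ⟨W, hW, hmW, hunit⟩ := exists_isUnit_modelRes hne
    refine hf (c.preimage W) ((c.preimage_mono hW).trans (c.preimage_image_le U)) ⟨hm, hmW⟩ ?_
    rw [← c.iso_modelRes_expr hW]
    exact hunit.map _

end Chart

theorem Supermanifold.hasLocalStalks {p q : ℕ} (M : Supermanifold.{u} p q) :
    M.HasLocalStalks := fun m U hU => by
  obtain ⟨c, hm, -⟩ := M.exists_chart m
  exact ⟨.ker (c.eval hm hU), fun f => (TwoSidedIdeal.mem_ker _).trans (c.eval_eq_zero_iff hm hU f)⟩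

end SuperGeom

end

theorem mainTheorem6_general (M : SuperGeom.SuperSpace) (hM : M.HasLocalStalks)
    (N : M.HomVF ⊤ 0) (α : M.OneForm) (hα : α.IsNondegenerate) {r : ℕ}
    (hr : α.DHasRank (r + 1) r) (σ : ZMod 2) (w : ℝ) (hσ : α.HasParity σ) (hw : α.HasWeight N w) :
    ∃ R : M.VF ⊤, α.IsReeb R ∧ (∀ R' : M.VF ⊤, α.IsReeb R' → R' = R) ∧
      (∀ m : M.carrier, ¬ SuperGeom.SuperSpace.VFVanishesAt R m) ∧
      SuperGeom.SuperSpace.VFHasParity R σ ∧ SuperGeom.SuperSpace.VFHasWeight N R (-w) := by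
  obtain ⟨R, hR⟩ := SuperGeom.SuperSpace.OneForm.exists_isReeb hα hr hM
  exact ⟨R, hR, fun R' hR' => hR'.eq hα hr hM hR, hR.not_vfVanishesAt hM,
    hR.hasParity hα hr hM hσ, hR.hasWeight hα hr hM hw⟩

theorem mainTheorem6 {p q : ℕ} (M : SuperGeom.Supermanifold p q)
    (N : M.HomVF ⊤ 0) (hN : SuperGeom.IsWeightVF M N)
    (α : M.OneForm) (hα : SuperGeom.IsContact M α)
    (σ : ZMod 2) (w : ℝ) (hσ : α.HasParity σ) (hw : α.HasWeight N w) :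
    ∃ R : M.VF ⊤,
      (α.contr R = 1 ∧ α.MemKerD R) ∧
      (∀ R' : M.VF ⊤, α.contr R' = 1 ∧ α.MemKerD R' → R' = R) ∧
      (∀ m : M.carrier, ¬ SuperGeom.SuperSpace.VFVanishesAt R m) ∧
      SuperGeom.SuperSpace.VFHasParity R σ ∧
      SuperGeom.SuperSpace.VFHasWeight N R (-w) := by
  obtain ⟨hnd, r, hr, hpq⟩ := hα
  exact mainTheorem6_general M.toSuperSpace M.hasLocalStalks N α hnd (hpq ▸ hr) σ w hσ hw
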